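/- Let $n_1,n_2,k,N$ be integers with $1\le k\le\min\{n_1,n_2\}$, let $B_1,\dots,B_N\in\mathbb{C}^{n_1\times n_2}$, and let $\tau=(k_1,\dots,k_t)$ with integers $k_i\ge 1$ and $k_1+\dots+k_t=k$. For $A\in\mathbb{C}^{k\times k}$, partitioned into blocks $A_{ij}\in\mathbb{C}^{k_i\times k_j}$, let $\mathrm{BDiag}_\tau(A)=\mathrm{diag}(A_{11},\dots,A_{tt})$. Let $\mathrm{St}(k,n)=\{P\in\mathbb{C}^{n\times k}: P^{H}P=I_k\}$. For $U=[U_1,\dots,U_t]\in\mathbb{C}^{n_1\times k}$ and $V=[V_1,\dots,V_t]\in\mathbb{C}^{n_2\times k}$, with $U_i$ and $V_i$ having $k_i$ columns, put $$f(U,V)=\sum_{\ell=1}^N\big\|\mathrm{BDiag}_\tau(U^{H}B_\ell V)\big\|_F^2$$ and let $H_1=\nabla_U f$, $H_2=\nabla_V f$ be its partial Euclidean gradients with respect to $\langle X,Y\rangle=\mathrm{Re}\,\mathrm{tr}(Y^{H}X)$, that is, $$H_1(U,V)=2\sum_{\ell=1}^N\big[B_\ell V_1(V_1^{H}B_\ell^{H}U_1),\dots,B_\ell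 V_t(V_t^{H}B_\ell^{H}U_t)\big],\qquad H_2(U,V)=2\sum_{\ell=1}^N\big[B_\ell^{H}U_1(U_1^{H}B_\ell V_1),\dots,B_\ell^{H}U_t(U_t^{H}B_\ell V_t)\big].$$ An orthonormal polar factor of $H\in\mathbb{C}^{n\times k}$ is a $W\in\mathrm{St}(k,n)$ such that $H=W\Lambda$ for some Hermitian $\Lambda\succeq 0$ (it need not be unique if $\mathrm{rank}\,H<k$). Let $(U^{(j)},V^{(j)})_{j\ge 0}$ be generated by the alternating iteration with Gauss-Seidel updating: $(U^{(0)},V^{(0)})\in\mathrm{St}(k,n_1)\times\mathrm{St}(k,n_2)$ and, for all $j\ge0$, $U^{(j+1)}$ is an orthonormal polar factor of $H_1^{(j)}:=H_1(U^{(j)},V^{(j)})$ and $V^{(j+1)}$ is an orthonormal polar factor of $\widehat H_2^{(j)}:=H_2(U^{(j+1)},V^{(j)})$. Then the following hold. (a) The sequence $f(U^{(j)},V^{(j)})$ is monotonically increasing (non-decreasing) and convergent. (b) Let $(U_*,V_*)$ be an accumulation point of $(U^{(j)},V^{(j)})_{j\ge0}$ and let $(U^{(j)},V^{(j)})_{j\in\mathbb{I}}$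 be a subsequence converging to it. Then $U_*\in\mathrm{St}(k,n_1)$, $V_*\in\mathrm{St}(k,n_2)$, the sequence $(U^{(j+1)})_{j\in\mathbb{I}}$ has an accumulation point, and for every accumulation point $\widehat U_*$ of $(U^{(j+1)})_{j\in\mathbb{I}}$, $$H_1(U_*,V_*)=U_*\Lambda_{1*},\quad \Lambda_{1*}=U_*^{H}H_1(U_*,V_*)\succeq0,\qquad H_2(\widehat U_*,V_*)=V_*\Lambda_{2*},\quad \Lambda_{2*}=V_*^{H}H_2(\widehat U_*,V_*)\succeq0.$$ As a result, if $\widehat U_*=U_*$, then $$H_1(U_*,V_*)=U_*\Lambda_{1*},\quad \Lambda_{1*}=U_*^{H}H_1(U_*,V_*)\succeq0,\qquad H_2(U_*,V_*)=V_*\Lambda_{2*},\quad \Lambda_{2*}=V_*^{H}H_2(U_*,V_*)\succeq0.\tag{1}$$ (c) In (b), if $\mathrm{rank}\,H_1(U_*,V_*)=k$, then $\widehat U_*=U_*$ for every such $\widehat U_*$, and hence (1) holds. (d) If $(U_*,V_*)$ is an isolated accumulation point of $(U^{(j)},V^{(j)})_{j\ge0}$ (some neighbourhood of it contains no other accumulation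 point of the sequence) and $\mathrm{rank}\,H_1(U_*,V_*)=\mathrm{rank}\,H_2(U_*,V_*)=k$, then the entire sequence $(U^{(j)},V^{(j)})$ converges to $(U_*,V_*)$. (e) Let $\sigma_{\min}(X)$ be the smallest of the $\min\{m,n\}$ singular values of $X\in\mathbb{C}^{m\times n}$, $\mathcal{R}(X)$ its column space, and $\Theta(\cdot,\cdot)$ the diagonal matrix of the canonical angles between two subspaces of equal dimension (the arccosines of the singular values of $X^{H}Y$ for matrices $X,Y$ whose columns are orthonormal bases of the two subspaces). Then the following four series converge: $$\sum_{j=0}^\infty\sigma_{\min}(H_1^{(j)})\,\big\|\sin\Theta\big(\mathcal{R}(U^{(j+1)}),\mathcal{R}(U^{(j)})\big)\big\|_F^2,\qquad \sum_{j=0}^\infty\sigma_{\min}(\widehat H_2^{(j)})\,\big\|\sin\Theta\big(\mathcal{R}(V^{(j+1)}),\mathcal{R}(V^{(j)})\big)\big\|_F^2,$$ $$\sum_{j=0}^\infty\sigma_{\min}(H_1^{(j)})\,\frac{\big\|H_1^{(j)}-U^{(j)}\big([U^{(j)}]^{H}H_1^{(j)}\big)\big\|_F^2}{\big\|H_1^{(j)}\big\|_F^2},\qquad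 \sum_{j=0}^\infty\sigma_{\min}(\widehat H_2^{(j)})\,\frac{\big\|\widehat H_2^{(j)}-V^{(j)}\big([V^{(j)}]^{H}\widehat H_2^{(j)}\big)\big\|_F^2}{\big\|\widehat H_2^{(j)}\big\|_F^2},$$ where a term of the last two series is read as $0$ if its denominator vanishes. -/

import Mathlib

open Filter Topology Matrix
open scoped ComplexOrder

noncomputable section

namespace JointSVD

/-- The Frobenius norm of a complex matrix. -/
def frobNorm {m n : ℕ} (A : Matrix (Fin m) (Fin n) ℂ) : ℝ :=
  Real.sqrt (∑ i, ∑ j, ‖A i j‖ ^ 2)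

/-- The complex Stiefel manifold of `n × k` matrices with orthonormal columns. -/
def stiefel (n k : ℕ) : Set (Matrix (Fin n) (Fin k) ℂ) :=
  {P | Pᴴ * P = 1}

/-- The block diagonal part of a `k × k` matrix with respect to `τ = (k₁, …, k_t)`, a list of
positive integers with sum `k`; `τ.index p` is the number of the block that contains `p`. -/
def blockDiagPart {k : ℕ} (τ : Composition k) (A : Matrix (Fin k) (Fin k) ℂ) :
    Matrix (Fin k) (Fin k) ℂ :=
  Matrix.of fun p q => if τ.index p = τ.index q then A p q else 0

section Objective

variable {n₁ n₂ k N : ℕ} (τ : Composition k) (B : Fin N → Matrix (Fin n₁) (Fin n₂) ℂ)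

/-- The objective function `f(U, V)`. -/
def objective (U : Matrix (Fin n₁) (Fin k) ℂ) (V : Matrix (Fin n₂) (Fin k) ℂ) : ℝ :=
  ∑ l, frobNorm (blockDiagPart τ (Uᴴ * B l * V)) ^ 2

/-- The partial gradient of `f` with respect to `U`. The block of columns number `i` of
`B V blockDiagPart (Vᴴ Bᴴ U)` is `B Vᵢ (Vᵢᴴ Bᴴ Uᵢ)`. -/
def gradU (U : Matrix (Fin n₁) (Fin k) ℂ) (V : Matrix (Fin n₂) (Fin k) ℂ) :
    Matrix (Fin n₁) (Fin k) ℂ :=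
  (2 : ℂ) • ∑ l, B l * V * blockDiagPart τ (Vᴴ * (B l)ᴴ * U)

/-- The partial gradient of `f` with respect to `V`. The block of columns number `i` of
`Bᴴ U blockDiagPart (Uᴴ B V)` is `Bᴴ Uᵢ (Uᵢᴴ B Vᵢ)`. -/
def gradV (U : Matrix (Fin n₁) (Fin k) ℂ) (V : Matrix (Fin n₂) (Fin k) ℂ) :
    Matrix (Fin n₂) (Fin k) ℂ :=
  (2 : ℂ) • ∑ l, (B l)ᴴ * U * blockDiagPart τ (Uᴴ * B l * V)

end Objective

/-- `G` is the Euclidean gradient of `g` at `P` for the inner product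
`⟨X, Y⟩ = Re tr (Yᴴ X)` on complex matrices. -/
def IsEuclideanGradient {n k : ℕ} (g : Matrix (Fin n) (Fin k) ℂ → ℝ)
    (P G : Matrix (Fin n) (Fin k) ℂ) : Prop :=
  (fun E => g (P + E) - g P - (trace (Eᴴ * G)).re) =o[𝓝 0] fun E => frobNorm E

lemma frobNorm_sq {m n : ℕ} (A : Matrix (Fin m) (Fin n) ℂ) :
    frobNorm A ^ 2 = ∑ i, ∑ j, ‖A i j‖ ^ 2 :=
  Real.sq_sqrt (by positivity)

lemma frobNorm_mul_sq_le {m n p : ℕ} (A : Matrix (Fin m) (Fin n) ℂ)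
    (C : Matrix (Fin n) (Fin p) ℂ) :
    frobNorm (A * C) ^ 2 ≤ frobNorm A ^ 2 * frobNorm C ^ 2 := by
  rw [frobNorm_sq, frobNorm_sq, frobNorm_sq, Finset.sum_mul]
  refine Finset.sum_le_sum fun i _ => ?_
  rw [Finset.sum_comm (s := Finset.univ (α := Fin n)), Finset.mul_sum]
  refine Finset.sum_le_sum fun j _ => ?_
  have h1 : ‖(A * C) i j‖ ≤ ∑ x, ‖A i x‖ * ‖C x j‖ := by
    rw [Matrix.mul_apply]
    exact (norm_sum_le _ _).trans (by simp)
  exact (pow_le_pow_left₀ (norm_nonneg _) h1 2).trans (Finset.sum_mul_sq_le_sq_mul_sq _ _ _)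

lemma frobNorm_blockDiagPart_sq_le {k : ℕ} (τ : Composition k) (A : Matrix (Fin k) (Fin k) ℂ) :
    frobNorm (blockDiagPart τ A) ^ 2 ≤ frobNorm A ^ 2 := by
  rw [frobNorm_sq, frobNorm_sq]
  refine Finset.sum_le_sum fun i _ => Finset.sum_le_sum fun j _ => ?_
  by_cases h : τ.index i = τ.index j
  · simp [blockDiagPart, h]
  · simp [blockDiagPart, h]

lemma frobNorm_conjTranspose {m n : ℕ} (A : Matrix (Fin m) (Fin n) ℂ) :
    frobNorm Aᴴ = frobNorm A := by
  unfold frobNorm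
  rw [Finset.sum_comm]
  simp

lemma blockDiagPart_conjTranspose {k : ℕ} (τ : Composition k) (A : Matrix (Fin k) (Fin k) ℂ) :
    blockDiagPart τ Aᴴ = (blockDiagPart τ A)ᴴ := by
  ext i j
  by_cases h : τ.index i = τ.index j
  · simp [blockDiagPart, h]
  · simp [blockDiagPart, h, Ne.symm h]

lemma frobNorm_blockDiagPart_add {k : ℕ} (τ : Composition k) (X Y : Matrix (Fin k) (Fin k) ℂ) :
    frobNorm (blockDiagPart τ (X + Y)) ^ 2 = frobNorm (blockDiagPart τ X) ^ 2 +
      2 * (trace (Y * blockDiagPart τ Xᴴ)).re + frobNorm (blockDiagPart τ Y) ^ 2 := by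
  simp only [frobNorm_sq, trace, diag_apply, Matrix.mul_apply, Complex.re_sum, Finset.mul_sum,
    ← Finset.sum_add_distrib]
  refine Finset.sum_congr rfl fun i _ => Finset.sum_congr rfl fun j _ => ?_
  by_cases h : τ.index i = τ.index j
  · simp only [blockDiagPart, Matrix.of_apply, h, if_true, Matrix.add_apply,
      conjTranspose_apply, Complex.sq_norm, Complex.normSq_apply]
    simp
    ring
  · simp [blockDiagPart, h, Ne.symm h]

lemma objective_add_left {n₁ n₂ k N : ℕ} (τ : Composition k)
    (B : Fin N → Matrix (Fin n₁) (Fin n₂) ℂ)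
    (U E : Matrix (Fin n₁) (Fin k) ℂ) (V : Matrix (Fin n₂) (Fin k) ℂ) :
    objective τ B (U + E) V =
      objective τ B U V + (trace (Eᴴ * gradU τ B U V)).re + objective τ B E V := by
  have h : (trace (Eᴴ * gradU τ B U V)).re =
      ∑ l, 2 * (trace (Eᴴ * B l * V * blockDiagPart τ (Uᴴ * B l * V)ᴴ)).re := by
    simp only [gradU, Matrix.mul_smul, Matrix.mul_sum, trace_smul, trace_sum, smul_eq_mul,
      Finset.mul_sum, Complex.re_sum]
    simp [Matrix.mul_assoc]
  rw [h]
  simp only [objective, ← Finset.sum_add_distrib]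
  refine Finset.sum_congr rfl fun l _ => ?_
  rw [← frobNorm_blockDiagPart_add]
  simp [Matrix.add_mul]

lemma objective_swap {n₁ n₂ k N : ℕ} (τ : Composition k)
    (B : Fin N → Matrix (Fin n₁) (Fin n₂) ℂ)
    (U : Matrix (Fin n₁) (Fin k) ℂ) (V : Matrix (Fin n₂) (Fin k) ℂ) :
    objective τ B U V = objective τ (fun l => (B l)ᴴ) V U := by
  unfold objective
  refine Finset.sum_congr rfl fun l _ => ?_
  rw [← frobNorm_conjTranspose, ← blockDiagPart_conjTranspose]
  simp [Matrix.mul_assoc]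

/-- `gradU` is the Euclidean gradient of the objective with respect to `U`. -/
theorem isEuclideanGradient_gradU {n₁ n₂ k N : ℕ} (τ : Composition k)
    (B : Fin N → Matrix (Fin n₁) (Fin n₂) ℂ)
    (U : Matrix (Fin n₁) (Fin k) ℂ) (V : Matrix (Fin n₂) (Fin k) ℂ) :
    IsEuclideanGradient (fun U' => objective τ B U' V) U (gradU τ B U V) := by
  have hcont : Tendsto (fun E : Matrix (Fin n₁) (Fin k) ℂ => frobNorm E) (𝓝 0) (𝓝 0) := by
    have : Continuous (fun E : Matrix (Fin n₁) (Fin k) ℂ => frobNorm E) := by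
      unfold frobNorm
      fun_prop
    simpa [frobNorm] using this.tendsto 0
  have hlo : (fun E : Matrix (Fin n₁) (Fin k) ℂ => frobNorm E ^ 2) =o[𝓝 0]
      fun E => frobNorm E := by
    simpa [pow_two] using ((Asymptotics.isLittleO_one_iff ℝ).2 hcont).mul_isBigO
      (Asymptotics.isBigO_refl (fun E : Matrix (Fin n₁) (Fin k) ℂ => frobNorm E) (𝓝 0))
  refine Asymptotics.IsBigO.trans_isLittleO ?_ hlo
  refine Asymptotics.IsBigO.of_bound (∑ l, frobNorm (B l * V) ^ 2) (Eventually.of_forall fun E => ?_)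
  have h0 : 0 ≤ objective τ B E V := Finset.sum_nonneg fun _ _ => sq_nonneg _
  beta_reduce
  rw [objective_add_left, show ∀ a b c : ℝ, a + b + c - a - b = c by intros; ring,
    Real.norm_of_nonneg h0, Real.norm_of_nonneg (sq_nonneg _), objective, Finset.sum_mul]
  refine Finset.sum_le_sum fun l _ => (frobNorm_blockDiagPart_sq_le _ _).trans ?_
  rw [Matrix.mul_assoc, mul_comm, ← frobNorm_conjTranspose E]
  exact frobNorm_mul_sq_le _ _

/-- `gradV` is the Euclidean gradient of the objective with respect to `V`. -/
theorem isEuclideanGradient_gradV {n₁ n₂ k N : ℕ} (τ : Composition k)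
    (B : Fin N → Matrix (Fin n₁) (Fin n₂) ℂ)
    (U : Matrix (Fin n₁) (Fin k) ℂ) (V : Matrix (Fin n₂) (Fin k) ℂ) :
    IsEuclideanGradient (fun V' => objective τ B U V') V (gradV τ B U V) := by
  have h := isEuclideanGradient_gradU τ (fun l => (B l)ᴴ) V U
  have hg : gradU τ (fun l => (B l)ᴴ) V U = gradV τ B U V := by
    simp [gradU, gradV]
  rw [hg] at h
  simpa only [← objective_swap] using h

/-- `W` is an orthonormal polar factor of `H`: it has orthonormal columns and `H = W Λ` for a
positive semidefinite `Λ`. It is unique if `H` has full column rank, and otherwise not. -/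
def IsOrthonormalPolarFactor {n k : ℕ} (W H : Matrix (Fin n) (Fin k) ℂ) : Prop :=
  W ∈ stiefel n k ∧ ∃ Λ : Matrix (Fin k) (Fin k) ℂ, Λ.PosSemidef ∧ H = W * Λ

/-- The sequence `(U j, V j)` is generated by the alternating SCF iteration with
Gauss-Seidel-type updating; any orthonormal polar factor may be taken at each step. -/
structure IsGaussSeidelASCF {n₁ n₂ k N : ℕ} (τ : Composition k)
    (B : Fin N → Matrix (Fin n₁) (Fin n₂) ℂ)
    (U : ℕ → Matrix (Fin n₁) (Fin k) ℂ) (V : ℕ → Matrix (Fin n₂) (Fin k) ℂ) : Prop where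
  init_U : U 0 ∈ stiefel n₁ k
  init_V : V 0 ∈ stiefel n₂ k
  step_U : ∀ j, IsOrthonormalPolarFactor (U (j + 1)) (gradU τ B (U j) (V j))
  step_V : ∀ j, IsOrthonormalPolarFactor (V (j + 1)) (gradV τ B (U (j + 1)) (V j))

/-- The polar-decomposition condition `H = W Λ` with `W` orthonormal and `Λ = Wᴴ H ⪰ 0`. -/
def PolarKKT {n k : ℕ} (W H : Matrix (Fin n) (Fin k) ℂ) : Prop :=
  W ∈ stiefel n k ∧ H = W * (Wᴴ * H) ∧ (Wᴴ * H).PosSemidef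

/-- The smallest of the `min m n` singular values of an `m × n` matrix
(Mathlib numbers the singular values from `0` in decreasing order). -/
def sigmaMin {m n : ℕ} (X : Matrix (Fin m) (Fin n) ℂ) : ℝ :=
  (Matrix.toEuclideanLin X).singularValues (min m n - 1)

/-- The column space of a matrix. -/
def colSpace {m n : ℕ} (X : Matrix (Fin m) (Fin n) ℂ) : Submodule ℂ (EuclideanSpace ℂ (Fin m)) :=
  LinearMap.range (Matrix.toEuclideanLin X)

/-- The canonical angles between two subspaces of equal dimension `d`: the arccosines of the `d`
singular values of the orthogonal projection onto `S`, restricted to `T`. In orthonormal bases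
`X` of `S` and `Y` of `T` this is the map with matrix `Xᴴ Y`. -/
def canonicalAngle {n : ℕ} (S T : Submodule ℂ (EuclideanSpace ℂ (Fin n))) (i : ℕ) : ℝ :=
  Real.arccos
    (LinearMap.singularValues (𝕜 := ℂ) (E := T) (F := S)
      (S.orthogonalProjectionOnto.toLinearMap ∘ₗ T.subtype) i)

/-- `‖sin Θ(S, T)‖_F` for the diagonal matrix `Θ(S, T)` of the canonical angles. -/
def sinThetaNorm {n : ℕ} (S T : Submodule ℂ (EuclideanSpace ℂ (Fin n))) : ℝ :=
  Real.sqrt (∑ i ∈ Finset.range (Module.finrank ℂ T), Real.sin (canonicalAngle S T i) ^ 2)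

/-- `p` is an isolated accumulation point of the sequence `s`. -/
def IsIsolatedAccPt {X : Type*} [TopologicalSpace X] (s : ℕ → X) (p : X) : Prop :=
  MapClusterPt p atTop s ∧ ∀ᶠ q in 𝓝[≠] p, ¬ MapClusterPt q atTop s

end JointSVD

end

/-!
In each of its variables `f` is a convex quadratic function, so it lies above its linearization:
an update `P ↦ W` of one variable raises `f` by at least the linear gain `Re tr ((W - P)ᴴ H)`, with
`H` the partial gradient at `P`. If `H = W Λ` is a polar decomposition and `P`, `W` have orthonormal
columns, this gain equals `½ tr ((W - P) Λ (W - P)ᴴ)`, hence is at least `½ σ_min(H) ‖W - P‖_F²`.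
As `f` is bounded on the Stiefel manifolds, the gains are summable. Both `‖sin Θ‖_F` and the
relative residual are at most `‖W - P‖_F`, which gives the four series.

At a limit the gain vanishes, which forces `W Λ = P Λ`: the limiting `P` is itself a polar factor of
the limiting gradient, and equals the limiting `W` if that gradient has full rank. Near an isolated
accumulation point with gradients of full rank, consecutive iterates therefore approach each other,
and a sequence that enters a small neighbourhood late enough never leaves it.
-/

namespace JointSVD

section Convergence

lemma summable_of_le_sub_of_bddAbove {a g : ℕ → ℝ} (ha : BddAbove (Set.range a))
    (hg : ∀ j, 0 ≤ g j) (hle : ∀ j, g j ≤ a (j + 1) - a j) : Summable g := by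
  obtain ⟨C, hC⟩ := ha
  refine summable_of_sum_range_le (c := C - a 0) hg fun m => ?_
  calc ∑ j ∈ Finset.range m, g j
      ≤ ∑ j ∈ Finset.range m, (a (j + 1) - a j) := Finset.sum_le_sum fun j _ => hle j
    _ = a m - a 0 := Finset.sum_range_sub a m
    _ ≤ C - a 0 := sub_le_sub_right (hC ⟨m, rfl⟩) _

variable {X : Type*} [TopologicalSpace X] {s : ℕ → X} {p : X}

lemma IsIsolatedAccPt.exists_mem_nhds_tendsto [RegularSpace X] {K : Set X} (hK : IsCompact K)
    (hs : ∀ j, s j ∈ K) (hp : IsIsolatedAccPt s p) :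
    ∃ D ∈ 𝓝 p, Tendsto s (atTop ⊓ 𝓟 (s ⁻¹' D)) (𝓝 p) := by
  obtain ⟨D, ⟨hDp, hDclosed⟩, hD⟩ :=
    (closed_nhds_basis p).mem_iff.mp (eventually_nhdsWithin_iff.mp hp.2)
  refine ⟨D, hDp, hK.tendsto_nhds_of_unique_mapClusterPt (Eventually.of_forall hs)
    fun q _ hq => ?_⟩
  have hqD : q ∈ D := hDclosed.mem_of_mapClusterPt hq
    (mem_inf_of_right (mem_principal_self _))
  by_contra hqp
  exact hD hqD hqp (hq.mono inf_le_left)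

lemma IsIsolatedAccPt.tendsto_of_tendsto_succ [RegularSpace X] {K : Set X} (hK : IsCompact K)
    (hs : ∀ j, s j ∈ K) (hp : IsIsolatedAccPt s p)
    (hsucc : ∀ F ≤ atTop, Tendsto s F (𝓝 p) → Tendsto (fun j => s (j + 1)) F (𝓝 p)) :
    Tendsto s atTop (𝓝 p) := by
  obtain ⟨D, hD, htendsto⟩ := hp.exists_mem_nhds_tendsto hK hs
  have hstay : ∀ᶠ j in atTop, s j ∈ D → s (j + 1) ∈ D :=
    eventually_inf_principal.mp ((hsucc _ inf_le_left htendsto).eventually hD)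
  obtain ⟨J, hJ⟩ := eventually_atTop.mp hstay
  obtain ⟨j₀, hj₀, hj₀D⟩ := frequently_atTop.mp (hp.1.frequently hD) J
  have hmem : ∀ j ≥ j₀, s j ∈ D := fun j hj =>
    Nat.le_induction hj₀D (fun i hi => hJ i (hj₀.trans hi)) j hj
  refine htendsto.mono_left (le_inf le_rfl (le_principal_iff.mpr ?_))
  exact (eventually_ge_atTop j₀).mono hmem

end Convergence

section SingularValues

variable {𝕜 E F : Type*} [RCLike 𝕜] [NormedAddCommGroup E] [InnerProductSpace 𝕜 E]
  [FiniteDimensional 𝕜 E] [NormedAddCommGroup F] [InnerProductSpace 𝕜 F] [FiniteDimensional 𝕜 F]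

/-- An orthonormal basis of right singular vectors of `T`, that is, of eigenvectors of `T* T`,
numbered in the order of `T.singularValues`. -/
noncomputable def rightSingularBasis (T : E →ₗ[𝕜] F) :
    OrthonormalBasis (Fin (Module.finrank 𝕜 E)) 𝕜 E :=
  T.isSymmetric_adjoint_comp_self.eigenvectorBasis rfl

lemma norm_apply_sq_eq_sum_singularValues (T : E →ₗ[𝕜] F) (x : E) :
    ‖T x‖ ^ 2 = ∑ i : Fin (Module.finrank 𝕜 E),
      T.singularValues i ^ 2 * ‖inner 𝕜 (rightSingularBasis T i) x‖ ^ 2 := by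
  have hcoord (i : Fin _) : inner 𝕜 (rightSingularBasis T i) ((LinearMap.adjoint T ∘ₗ T) x) =
      (T.singularValues i ^ 2 : 𝕜) * inner 𝕜 (rightSingularBasis T i) x := by
    rw [← T.isSymmetric_adjoint_comp_self, rightSingularBasis,
      LinearMap.IsSymmetric.apply_eigenvectorBasis, inner_smul_left, RCLike.conj_ofReal,
      ← T.sq_singularValues_fin rfl]
    push_cast
    rfl
  have hinner : ((‖T x‖ ^ 2 : ℝ) : 𝕜) =
      ((∑ i : Fin (Module.finrank 𝕜 E),
        T.singularValues i ^ 2 * ‖inner 𝕜 (rightSingularBasis T i) x‖ ^ 2 : ℝ) : 𝕜) := by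
    calc ((‖T x‖ ^ 2 : ℝ) : 𝕜) = inner 𝕜 x ((LinearMap.adjoint T ∘ₗ T) x) := by
          rw [LinearMap.comp_apply, LinearMap.adjoint_inner_right, inner_self_eq_norm_sq_to_K]
          push_cast
          rfl
      _ = ∑ i : Fin (Module.finrank 𝕜 E), inner 𝕜 x (rightSingularBasis T i) *
            ((T.singularValues i ^ 2 : 𝕜) * inner 𝕜 (rightSingularBasis T i) x) := by
          rw [← (rightSingularBasis T).sum_inner_mul_inner]
          simp_rw [hcoord]
      _ = _ := by
          push_cast
          refine Finset.sum_congr rfl fun i _ => ?_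
          rw [mul_left_comm, ← inner_conj_symm x, RCLike.conj_mul]
  exact RCLike.ofReal_injective hinner

lemma norm_apply_rightSingularBasis (T : E →ₗ[𝕜] F) (i : Fin (Module.finrank 𝕜 E)) :
    ‖T (rightSingularBasis T i)‖ = T.singularValues i := by
  rw [← sq_eq_sq₀ (norm_nonneg _) (T.singularValues_nonneg i),
    norm_apply_sq_eq_sum_singularValues,
    Finset.sum_eq_single i (fun j _ hj => by simp [(rightSingularBasis T).orthonormal.2 hj])
      (by simp)]
  simp

lemma singularValues_le_one (T : E →ₗ[𝕜] F) (hT : ∀ x, ‖T x‖ ≤ ‖x‖) (i : ℕ) :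
    T.singularValues i ≤ 1 := by
  rcases lt_or_ge i (Module.finrank 𝕜 E) with hi | hi
  · simpa [norm_apply_rightSingularBasis] using hT (rightSingularBasis T ⟨i, hi⟩)
  · exact (T.singularValues_of_finrank_le hi).trans_le zero_le_one

lemma singularValues_finrank_sub_one_mul_norm_le (T : E →ₗ[𝕜] F) (x : E) :
    T.singularValues (Module.finrank 𝕜 E - 1) * ‖x‖ ≤ ‖T x‖ := by
  refine le_of_sq_le_sq ?_ (norm_nonneg _)
  rw [mul_pow, norm_apply_sq_eq_sum_singularValues,
    ← (rightSingularBasis T).sum_sq_norm_inner_right x, Finset.mul_sum]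
  gcongr with i
  · exact T.singularValues_nonneg _
  · exact T.singularValues_antitone (Nat.le_sub_one_of_lt i.isLt)

lemma sum_sq_singularValues {ι : Type*} [Fintype ι] (T : E →ₗ[𝕜] F)
    (b : OrthonormalBasis ι 𝕜 E) :
    ∑ i ∈ Finset.range (Module.finrank 𝕜 E), T.singularValues i ^ 2 = ∑ j, ‖T (b j)‖ ^ 2 := by
  simp_rw [norm_apply_sq_eq_sum_singularValues T]
  rw [Finset.sum_comm, Finset.sum_range]
  simp_rw [← Finset.mul_sum, b.sum_sq_norm_inner_left, OrthonormalBasis.norm_eq_one, one_pow,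
    mul_one]

lemma sum_sq_sin_arccos_singularValues {ι : Type*} [Fintype ι] (T : E →ₗ[𝕜] F)
    (hT : ∀ x, ‖T x‖ ≤ ‖x‖) (b : OrthonormalBasis ι 𝕜 E) :
    ∑ i ∈ Finset.range (Module.finrank 𝕜 E), Real.sin (Real.arccos (T.singularValues i)) ^ 2 =
      ∑ j, (1 - ‖T (b j)‖ ^ 2) := by
  have hsin (i : ℕ) : Real.sin (Real.arccos (T.singularValues i)) ^ 2 =
      1 - T.singularValues i ^ 2 := by
    rw [Real.sin_arccos, Real.sq_sqrt]
    exact sub_nonneg.mpr (pow_le_one₀ (T.singularValues_nonneg i) (singularValues_le_one T hT i))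
  simp_rw [hsin]
  rw [Finset.sum_sub_distrib, Finset.sum_sub_distrib, sum_sq_singularValues T b]
  simp [Module.finrank_eq_card_basis b.toBasis]

end SingularValues

section Matrices

variable {𝕜 m n : Type*} [RCLike 𝕜] [Fintype m] [Fintype n]

lemma isUnit_of_rank_eq_card {K : Type*} [Field K] [DecidableEq n] {A : Matrix n n K}
    (hA : A.rank = Fintype.card n) : IsUnit A := by
  rw [← Matrix.mulVec_surjective_iff_isUnit]
  have hrange : LinearMap.range A.mulVecLin = ⊤ :=
    Submodule.eq_top_of_finrank_eq (hA.trans (Module.finrank_fintype_fun_eq_card K).symm)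
  exact LinearMap.range_eq_top.mp hrange

lemma isClosed_setOf_posSemidef {ι : Type*} [Finite ι] :
    IsClosed {A : Matrix ι ι 𝕜 | A.PosSemidef} := by
  have := Fintype.ofFinite ι
  simp only [posSemidef_iff_dotProduct_mulVec, IsHermitian, Set.ofPred_and, Set.ofPred_forall]
  refine (isClosed_eq (by fun_prop) (by fun_prop)).inter (isClosed_iInter fun x => ?_)
  exact isClosed_le continuous_const
    (continuous_const.dotProduct (continuous_id.matrix_mulVec continuous_const))

open scoped MatrixOrder in
lemma posSemidef_sub_smul_one_of_le_eigenvalues [DecidableEq n] {A : Matrix n n 𝕜}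
    (hA : A.IsHermitian) {c : ℝ} (hc : ∀ i, c ≤ hA.eigenvalues i) :
    (A - c • (1 : Matrix n n 𝕜)).PosSemidef := by
  rw [← Matrix.le_iff, ← Algebra.algebraMap_eq_smul_one,
    algebraMap_le_iff_le_spectrum (a := A) hA, hA.spectrum_real_eq_range_eigenvalues]
  rintro _ ⟨i, rfl⟩
  exact hc i

open scoped MatrixOrder in
lemma mul_eq_zero_of_re_trace_mul_mul_conjTranspose_eq_zero {Λ : Matrix n n 𝕜}
    (hΛ : Λ.PosSemidef) {X : Matrix m n 𝕜} (h : RCLike.re (trace (X * Λ * Xᴴ)) = 0) :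
    X * Λ = 0 := by
  have hpos := hΛ.mul_mul_conjTranspose_same X
  have htrace : trace (X * Λ * Xᴴ) = 0 :=
    RCLike.ext (by simpa using h) (by simpa using (RCLike.nonneg_iff.mp hpos.trace_nonneg).2)
  have hzero : X * Λ * Xᴴ = 0 := hpos.trace_eq_zero_iff.mp htrace
  classical
  obtain ⟨C, rfl⟩ := (CStarAlgebra.nonneg_iff_eq_star_mul_self (a := Λ)).mp hΛ.nonneg
  rw [star_eq_conjTranspose] at hzero ⊢
  have hCX : C * Xᴴ = 0 := by
    rw [← conjTranspose_mul_self_eq_zero]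
    simpa [Matrix.mul_assoc] using hzero
  have hXC : X * Cᴴ = 0 := by simpa using congrArg conjTranspose hCX
  rw [← Matrix.mul_assoc, hXC, Matrix.zero_mul]

lemma two_mul_re_trace_conjTranspose_sub_mul {P W : Matrix m n 𝕜} {Λ : Matrix n n 𝕜}
    (hWP : Wᴴ * W = Pᴴ * P) (hΛ : Λ.IsHermitian) :
    2 * RCLike.re (trace ((W - P)ᴴ * (W * Λ))) =
      RCLike.re (trace ((W - P) * Λ * (W - P)ᴴ)) := by
  have hcross : RCLike.re (trace (Wᴴ * P * Λ)) = RCLike.re (trace (Pᴴ * W * Λ)) := by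
    have hstar : trace (Wᴴ * P * Λ) = star (trace (Pᴴ * W * Λ)) := by
      rw [← trace_conjTranspose, conjTranspose_mul, conjTranspose_mul, hΛ.eq,
        conjTranspose_conjTranspose, trace_mul_comm]
    simp [hstar]
  rw [trace_mul_comm _ (W - P)ᴴ]
  simp only [conjTranspose_sub, Matrix.sub_mul, Matrix.mul_sub, trace_sub, map_sub,
    ← Matrix.mul_assoc, hWP, hcross]
  ring

end Matrices

section FrobeniusNorm

variable {m n k : ℕ}

lemma frobNorm_sq_eq_re_trace (A : Matrix (Fin m) (Fin n) ℂ) :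
    frobNorm A ^ 2 = (trace (Aᴴ * A)).re := by
  rw [frobNorm_sq, Finset.sum_comm]
  simp [trace, Matrix.mul_apply, Complex.sq_norm, Complex.normSq_apply]

lemma norm_apply_le_frobNorm (A : Matrix (Fin m) (Fin n) ℂ) (i : Fin m) (j : Fin n) :
    ‖A i j‖ ≤ frobNorm A := by
  refine Real.le_sqrt_of_sq_le ?_
  calc ‖A i j‖ ^ 2 ≤ ∑ j, ‖A i j‖ ^ 2 :=
        Finset.single_le_sum (f := fun j => ‖A i j‖ ^ 2) (fun _ _ => sq_nonneg _)
          (Finset.mem_univ j)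
    _ ≤ ∑ i, ∑ j, ‖A i j‖ ^ 2 :=
        Finset.single_le_sum (f := fun i => ∑ j, ‖A i j‖ ^ 2)
          (fun _ _ => Finset.sum_nonneg fun _ _ => sq_nonneg _) (Finset.mem_univ i)

lemma frobNorm_sq_of_mem_stiefel {P : Matrix (Fin n) (Fin k) ℂ} (hP : P ∈ stiefel n k) :
    frobNorm P ^ 2 = k := by
  rw [frobNorm_sq_eq_re_trace, show Pᴴ * P = 1 from hP]
  simp

lemma frobNorm_mul_of_mem_stiefel {P : Matrix (Fin n) (Fin k) ℂ} (hP : P ∈ stiefel n k)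
    (A : Matrix (Fin k) (Fin m) ℂ) : frobNorm (P * A) ^ 2 = frobNorm A ^ 2 := by
  rw [frobNorm_sq_eq_re_trace, frobNorm_sq_eq_re_trace, conjTranspose_mul, Matrix.mul_assoc,
    ← Matrix.mul_assoc Pᴴ, show Pᴴ * P = 1 from hP, Matrix.one_mul]

lemma frobNorm_sub_mul_conjTranspose_mul_sq {P : Matrix (Fin n) (Fin k) ℂ}
    (hP : P ∈ stiefel n k) (A : Matrix (Fin n) (Fin m) ℂ) :
    frobNorm (A - P * (Pᴴ * A)) ^ 2 = frobNorm A ^ 2 - frobNorm (Pᴴ * A) ^ 2 := by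
  have hcancel : Pᴴ * (P * (Pᴴ * A)) = Pᴴ * A := by
    rw [← Matrix.mul_assoc, show Pᴴ * P = 1 from hP, Matrix.one_mul]
  have hgram : (A - P * (Pᴴ * A))ᴴ * (A - P * (Pᴴ * A)) = Aᴴ * A - (Pᴴ * A)ᴴ * (Pᴴ * A) := by
    simp [Matrix.sub_mul, Matrix.mul_sub, Matrix.mul_assoc, hcancel]
  simp only [frobNorm_sq_eq_re_trace, hgram, trace_sub, Complex.sub_re]

lemma isClosed_stiefel : IsClosed (stiefel n k) :=
  isClosed_eq (by fun_prop) continuous_const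

lemma isCompact_stiefel : IsCompact (stiefel n k) := by
  have hbox : IsCompact (Set.univ.pi fun _ : Fin n => Set.univ.pi fun _ : Fin k =>
      Metric.closedBall (0 : ℂ) (Real.sqrt k)) :=
    isCompact_univ_pi fun _ => isCompact_univ_pi fun _ => isCompact_closedBall _ _
  refine IsCompact.of_isClosed_subset (X := Matrix (Fin n) (Fin k) ℂ) hbox isClosed_stiefel
    fun P hP i _ j _ => mem_closedBall_zero_iff.mpr ((norm_apply_le_frobNorm P i j).trans ?_)
  exact Real.le_sqrt_of_sq_le (frobNorm_sq_of_mem_stiefel hP).le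

lemma le_of_mem_stiefel {P : Matrix (Fin n) (Fin k) ℂ} (hP : P ∈ stiefel n k) : k ≤ n :=
  calc k = (Pᴴ * P).rank := by simp [show Pᴴ * P = 1 from hP]
    _ = P.rank := rank_conjTranspose_mul_self P
    _ ≤ n := rank_le_height P

/-- The linear isometry `x ↦ P x` given by a matrix `P` with orthonormal columns. -/
noncomputable def stiefelIsometry {P : Matrix (Fin n) (Fin k) ℂ} (hP : P ∈ stiefel n k) :
    EuclideanSpace ℂ (Fin k) →ₗᵢ[ℂ] EuclideanSpace ℂ (Fin n) :=
  (Matrix.toEuclideanLin P).isometryOfInner fun x y => by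
    rw [← LinearMap.adjoint_inner_right, ← Matrix.toEuclideanLin_conjTranspose_eq_adjoint]
    congr 1
    ext i
    simp [Matrix.toLpLin_apply, Matrix.mulVec_mulVec, show Pᴴ * P = 1 from hP]

lemma sigmaMin_nonneg (X : Matrix (Fin m) (Fin n) ℂ) : 0 ≤ sigmaMin X :=
  LinearMap.singularValues_nonneg _ _

lemma sigmaMin_mul_norm_le (hnm : n ≤ m) (X : Matrix (Fin m) (Fin n) ℂ)
    (x : EuclideanSpace ℂ (Fin n)) : sigmaMin X * ‖x‖ ≤ ‖Matrix.toEuclideanLin X x‖ := by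
  simpa [sigmaMin, min_eq_right hnm] using
    singularValues_finrank_sub_one_mul_norm_le (Matrix.toEuclideanLin X) x

end FrobeniusNorm

section CanonicalAngles

variable {n k : ℕ} {ι : Type*} [Fintype ι] {S T : Submodule ℂ (EuclideanSpace ℂ (Fin n))}

lemma sinThetaNorm_sq (b : OrthonormalBasis ι ℂ T) :
    sinThetaNorm S T ^ 2 =
      ∑ j, ‖(b j : EuclideanSpace ℂ (Fin n)) - S.starProjection (b j)‖ ^ 2 := by
  have hcontr (x : T) : ‖(S.orthogonalProjectionOnto.toLinearMap ∘ₗ T.subtype) x‖ ≤ ‖x‖ :=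
    S.norm_orthogonalProjectionOnto_apply_le x
  rw [sinThetaNorm, Real.sq_sqrt (Finset.sum_nonneg fun _ _ => sq_nonneg _)]
  refine (sum_sq_sin_arccos_singularValues _ hcontr b).trans (Finset.sum_congr rfl fun j _ => ?_)
  have hnorm : ‖(b j : EuclideanSpace ℂ (Fin n))‖ = 1 := b.orthonormal.1 j
  have hpyth := S.norm_sq_eq_add_norm_sq_starProjection (b j : EuclideanSpace ℂ (Fin n))
  rw [hnorm, one_pow, Submodule.starProjection_orthogonal_val] at hpyth
  exact sub_eq_of_eq_add' hpyth

lemma sinThetaNorm_sq_le_of_mem (b : OrthonormalBasis ι ℂ T)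
    {s : ι → EuclideanSpace ℂ (Fin n)} (hs : ∀ j, s j ∈ S) :
    sinThetaNorm S T ^ 2 ≤ ∑ j, ‖(b j : EuclideanSpace ℂ (Fin n)) - s j‖ ^ 2 := by
  rw [sinThetaNorm_sq b]
  gcongr with j
  rw [Submodule.starProjection_minimal]
  exact ciInf_le ⟨0, Set.forall_mem_range.mpr fun _ => norm_nonneg _⟩ (⟨s j, hs j⟩ : S)

/-- The columns of a matrix with orthonormal columns, as an orthonormal basis of its column
space. -/
noncomputable def colBasis {P : Matrix (Fin n) (Fin k) ℂ} (hP : P ∈ stiefel n k) :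
    OrthonormalBasis (Fin k) ℂ (colSpace P) :=
  (EuclideanSpace.basisFun (Fin k) ℂ).map (stiefelIsometry hP).equivRange

lemma colBasis_apply {P : Matrix (Fin n) (Fin k) ℂ} (hP : P ∈ stiefel n k) (j : Fin k) :
    (colBasis hP j : EuclideanSpace ℂ (Fin n)) =
      Matrix.toEuclideanLin P (EuclideanSpace.single j 1) :=
  congrArg (Matrix.toEuclideanLin P) (EuclideanSpace.basisFun_apply (Fin k) ℂ j)

lemma sinThetaNorm_colSpace_sq_le (W : Matrix (Fin n) (Fin k) ℂ) {P : Matrix (Fin n) (Fin k) ℂ}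
    (hP : P ∈ stiefel n k) :
    sinThetaNorm (colSpace W) (colSpace P) ^ 2 ≤ frobNorm (W - P) ^ 2 := by
  refine (sinThetaNorm_sq_le_of_mem (colBasis hP) fun j =>
    LinearMap.mem_range_self (Matrix.toEuclideanLin W) (EuclideanSpace.single j 1)).trans_eq ?_
  rw [frobNorm_sq, Finset.sum_comm]
  refine Finset.sum_congr rfl fun j _ => ?_
  rw [norm_sub_rev, EuclideanSpace.norm_sq_eq, colBasis_apply]
  simp [Matrix.toLpLin_apply]

end CanonicalAngles

section PolarFactors

variable {n k : ℕ} {P W H : Matrix (Fin n) (Fin k) ℂ}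

/-- The increase of the linear functional `X ↦ Re tr (Xᴴ H)` from `P` to `W`. -/
def linearGain (H P W : Matrix (Fin n) (Fin k) ℂ) : ℝ :=
  (trace ((W - P)ᴴ * H)).re

lemma isOrthonormalPolarFactor_iff_polarKKT : IsOrthonormalPolarFactor W H ↔ PolarKKT W H := by
  refine ⟨?_, fun h => ⟨h.1, _, h.2.2, h.2.1⟩⟩
  rintro ⟨hW, Λ, hΛ, rfl⟩
  have hΛ_eq : Wᴴ * (W * Λ) = Λ := by
    rw [← Matrix.mul_assoc, show Wᴴ * W = 1 from hW, Matrix.one_mul]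
  exact ⟨hW, by rw [hΛ_eq], by rwa [hΛ_eq]⟩

lemma isClosed_setOf_isOrthonormalPolarFactor :
    IsClosed {p : Matrix (Fin n) (Fin k) ℂ × Matrix (Fin n) (Fin k) ℂ |
      IsOrthonormalPolarFactor p.1 p.2} := by
  simp only [isOrthonormalPolarFactor_iff_polarKKT, PolarKKT, Set.ofPred_and]
  refine (isClosed_stiefel.preimage continuous_fst).inter (IsClosed.inter ?_ ?_)
  · exact isClosed_eq (by fun_prop) (by fun_prop)
  · exact isClosed_setOf_posSemidef.preimage
      (f := fun p : Matrix (Fin n) (Fin k) ℂ × Matrix (Fin n) (Fin k) ℂ => p.1ᴴ * p.2)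
      (by fun_prop)

lemma sigmaMin_le_eigenvalues {Λ : Matrix (Fin k) (Fin k) ℂ} (hW : W ∈ stiefel n k)
    (hΛ : Λ.PosSemidef) (i : Fin k) : sigmaMin (W * Λ) ≤ hΛ.isHermitian.eigenvalues i := by
  set v := hΛ.isHermitian.eigenvectorBasis i
  set μ := hΛ.isHermitian.eigenvalues i
  have hv : ‖v‖ = 1 := hΛ.isHermitian.eigenvectorBasis.norm_eq_one i
  have happly : Matrix.toEuclideanLin (W * Λ) v = stiefelIsometry hW (μ • v) := by
    have hΛv : Matrix.toEuclideanLin Λ v = μ • v :=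
      congrArg (WithLp.toLp 2) (hΛ.isHermitian.mulVec_eigenvectorBasis i)
    rw [← hΛv, Matrix.toLpLin_mul (q := 2)]
    rfl
  calc sigmaMin (W * Λ) = sigmaMin (W * Λ) * ‖v‖ := by rw [hv, mul_one]
    _ ≤ ‖stiefelIsometry hW (μ • v)‖ :=
        happly ▸ sigmaMin_mul_norm_le (le_of_mem_stiefel hW) (W * Λ) v
    _ = μ := by
        rw [LinearIsometry.norm_map, norm_smul, hv, mul_one,
          Real.norm_of_nonneg (hΛ.eigenvalues_nonneg i)]

lemma two_mul_linearGain_mul {Λ : Matrix (Fin k) (Fin k) ℂ} (hW : W ∈ stiefel n k)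
    (hP : P ∈ stiefel n k) (hΛ : Λ.IsHermitian) :
    2 * linearGain (W * Λ) P W = (trace ((W - P) * Λ * (W - P)ᴴ)).re :=
  two_mul_re_trace_conjTranspose_sub_mul (Eq.trans hW (Eq.symm hP)) hΛ

lemma sigmaMin_mul_frobNorm_sub_sq_le (hW : IsOrthonormalPolarFactor W H)
    (hP : P ∈ stiefel n k) :
    sigmaMin H * frobNorm (W - P) ^ 2 ≤ 2 * linearGain H P W := by
  obtain ⟨hW, Λ, hΛ, rfl⟩ := hW
  have hshift := posSemidef_sub_smul_one_of_le_eigenvalues hΛ.isHermitian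
    (sigmaMin_le_eigenvalues hW hΛ)
  have htrace := (Complex.le_def.mp (hshift.mul_mul_conjTranspose_same (W - P)).trace_nonneg).1
  rw [Matrix.mul_sub, Matrix.sub_mul, trace_sub, Matrix.mul_smul, Matrix.mul_one, Matrix.smul_mul,
    trace_smul, Complex.sub_re, Complex.smul_re, trace_mul_comm (W - P) (W - P)ᴴ,
    ← frobNorm_sq_eq_re_trace] at htrace
  rw [two_mul_linearGain_mul hW hP hΛ.isHermitian]
  exact sub_nonneg.mp htrace

lemma linearGain_nonneg (hW : IsOrthonormalPolarFactor W H) (hP : P ∈ stiefel n k) :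
    0 ≤ linearGain H P W := by
  have hle := sigmaMin_mul_frobNorm_sub_sq_le hW hP
  have hnonneg := mul_nonneg (sigmaMin_nonneg H) (sq_nonneg (frobNorm (W - P)))
  linarith

lemma mul_eq_mul_of_linearGain_eq_zero {Λ : Matrix (Fin k) (Fin k) ℂ} (hW : W ∈ stiefel n k)
    (hP : P ∈ stiefel n k) (hΛ : Λ.PosSemidef) (hgain : linearGain (W * Λ) P W = 0) :
    W * Λ = P * Λ := by
  have hzero : (W - P) * Λ = 0 := mul_eq_zero_of_re_trace_mul_mul_conjTranspose_eq_zero hΛ <| by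
    simpa [hgain] using (two_mul_linearGain_mul hW hP hΛ.isHermitian).symm
  rwa [Matrix.sub_mul, sub_eq_zero] at hzero

lemma IsOrthonormalPolarFactor.of_linearGain_eq_zero (hW : IsOrthonormalPolarFactor W H)
    (hP : P ∈ stiefel n k) (hgain : linearGain H P W = 0) : IsOrthonormalPolarFactor P H := by
  obtain ⟨hW, Λ, hΛ, rfl⟩ := hW
  exact ⟨hP, Λ, hΛ, mul_eq_mul_of_linearGain_eq_zero hW hP hΛ hgain⟩

lemma IsOrthonormalPolarFactor.eq_of_linearGain_eq_zero (hW : IsOrthonormalPolarFactor W H)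
    (hP : P ∈ stiefel n k) (hgain : linearGain H P W = 0) (hrank : H.rank = k) : W = P := by
  obtain ⟨hW, Λ, hΛ, rfl⟩ := hW
  have hΛ_rank : Λ.rank = Fintype.card (Fin k) := le_antisymm (rank_le_card_width Λ) <| by
    simpa [hrank] using rank_mul_le_right W Λ
  have hΛ_det : IsUnit Λ.det := (isUnit_iff_isUnit_det Λ).mp (isUnit_of_rank_eq_card hΛ_rank)
  rw [← mul_nonsing_inv_cancel_right Λ W hΛ_det,
    mul_eq_mul_of_linearGain_eq_zero hW hP hΛ hgain, mul_nonsing_inv_cancel_right Λ P hΛ_det]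

lemma frobNorm_residual_div_le (hW : IsOrthonormalPolarFactor W H) (hP : P ∈ stiefel n k) :
    frobNorm (H - P * (Pᴴ * H)) ^ 2 / frobNorm H ^ 2 ≤ frobNorm (W - P) ^ 2 := by
  obtain ⟨hW, Λ, -, rfl⟩ := hW
  refine div_le_of_le_mul₀ (sq_nonneg _) (sq_nonneg _) ?_
  have hcancel : P * (Pᴴ * (P * Λ)) = P * Λ := by
    rw [← Matrix.mul_assoc Pᴴ, show Pᴴ * P = 1 from hP, Matrix.one_mul]
  have hresidual : W * Λ - P * (Pᴴ * (W * Λ)) =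
      (W - P) * Λ - P * (Pᴴ * ((W - P) * Λ)) := by
    rw [Matrix.sub_mul, Matrix.mul_sub Pᴴ, Matrix.mul_sub P, hcancel]
    abel
  calc frobNorm (W * Λ - P * (Pᴴ * (W * Λ))) ^ 2
      ≤ frobNorm ((W - P) * Λ) ^ 2 := by
        rw [hresidual, frobNorm_sub_mul_conjTranspose_mul_sq hP]
        exact sub_le_self _ (sq_nonneg _)
    _ ≤ frobNorm (W - P) ^ 2 * frobNorm Λ ^ 2 := frobNorm_mul_sq_le _ _
    _ = frobNorm (W - P) ^ 2 * frobNorm (W * Λ) ^ 2 := by rw [frobNorm_mul_of_mem_stiefel hW]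

end PolarFactors

section PolarSequences

variable {n k : ℕ} {ι : Type*} {P W H : ι → Matrix (Fin n) (Fin k) ℂ} {F : Filter ι}
  {Ps Ws Hs : Matrix (Fin n) (Fin k) ℂ}

lemma isOrthonormalPolarFactor_and_linearGain_eq_zero_of_mapClusterPt
    (hW : ∀ i, IsOrthonormalPolarFactor (W i) (H i)) (hPs : Tendsto P F (𝓝 Ps))
    (hHs : Tendsto H F (𝓝 Hs)) (hgain : Tendsto (fun i => linearGain (H i) (P i) (W i)) F (𝓝 0))
    (hWs : MapClusterPt Ws F W) : IsOrthonormalPolarFactor Ws Hs ∧ linearGain Hs Ps Ws = 0 := by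
  obtain ⟨G, hGF, hG⟩ := mapClusterPt_iff_ultrafilter.mp hWs
  have hpolar := isClosed_setOf_isOrthonormalPolarFactor.mem_of_tendsto
    (hG.prodMk_nhds (hHs.mono_left hGF)) (Eventually.of_forall hW)
  refine ⟨hpolar, ?_⟩
  have hcont : Continuous fun p : Matrix (Fin n) (Fin k) ℂ × Matrix (Fin n) (Fin k) ℂ ×
      Matrix (Fin n) (Fin k) ℂ => linearGain p.1 p.2.1 p.2.2 := by
    unfold linearGain
    fun_prop
  have hlim : Tendsto (fun i => (H i, P i, W i)) G (𝓝 (Hs, Ps, Ws)) :=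
    (hHs.mono_left hGF).prodMk_nhds ((hPs.mono_left hGF).prodMk_nhds hG)
  exact tendsto_nhds_unique ((hcont.tendsto (Hs, Ps, Ws)).comp hlim) (hgain.mono_left hGF)

lemma polarKKT_of_tendsto_linearGain [F.NeBot]
    (hW : ∀ i, IsOrthonormalPolarFactor (W i) (H i)) (hP : ∀ i, P i ∈ stiefel n k)
    (hPs : Tendsto P F (𝓝 Ps)) (hHs : Tendsto H F (𝓝 Hs))
    (hgain : Tendsto (fun i => linearGain (H i) (P i) (W i)) F (𝓝 0)) : PolarKKT Ps Hs := by
  obtain ⟨Ws, -, hWs⟩ := isCompact_stiefel.exists_mapClusterPt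
    (tendsto_principal.mpr (Eventually.of_forall fun i => (hW i).1) : map W F ≤ _)
  obtain ⟨hpolar, hzero⟩ :=
    isOrthonormalPolarFactor_and_linearGain_eq_zero_of_mapClusterPt hW hPs hHs hgain hWs
  have hPs_mem : Ps ∈ stiefel n k :=
    isClosed_stiefel.mem_of_tendsto hPs (Eventually.of_forall hP)
  exact isOrthonormalPolarFactor_iff_polarKKT.mp (hpolar.of_linearGain_eq_zero hPs_mem hzero)

lemma tendsto_of_tendsto_linearGain
    (hW : ∀ i, IsOrthonormalPolarFactor (W i) (H i)) (hP : ∀ i, P i ∈ stiefel n k)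
    (hPs : Tendsto P F (𝓝 Ps)) (hHs : Tendsto H F (𝓝 Hs))
    (hgain : Tendsto (fun i => linearGain (H i) (P i) (W i)) F (𝓝 0)) (hrank : Hs.rank = k) :
    Tendsto W F (𝓝 Ps) := by
  refine isCompact_stiefel.tendsto_nhds_of_unique_mapClusterPt
    (Eventually.of_forall fun i => (hW i).1) fun Ws _ hWs => ?_
  obtain ⟨hpolar, hzero⟩ :=
    isOrthonormalPolarFactor_and_linearGain_eq_zero_of_mapClusterPt hW hPs hHs hgain hWs
  have : F.NeBot := (hWs.neBot.mono inf_le_right).of_map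
  have hPs_mem : Ps ∈ stiefel n k :=
    isClosed_stiefel.mem_of_tendsto hPs (Eventually.of_forall hP)
  exact hpolar.eq_of_linearGain_eq_zero hPs_mem hzero hrank

lemma summable_sigmaMin_mul_of_le_frobNorm_sub_sq
    (hW : ∀ i, IsOrthonormalPolarFactor (W i) (H i)) (hP : ∀ i, P i ∈ stiefel n k)
    (hgain : Summable fun i => linearGain (H i) (P i) (W i)) {g : ι → ℝ} (hg : ∀ i, 0 ≤ g i)
    (hle : ∀ i, g i ≤ frobNorm (W i - P i) ^ 2) : Summable fun i => sigmaMin (H i) * g i :=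
  Summable.of_nonneg_of_le (fun i => mul_nonneg (sigmaMin_nonneg _) (hg i))
    (fun i => (mul_le_mul_of_nonneg_left (hle i) (sigmaMin_nonneg _)).trans
      (sigmaMin_mul_frobNorm_sub_sq_le (hW i) (hP i)))
    (hgain.mul_left 2)

lemma summable_sigmaMin_mul_sinThetaNorm_sq
    (hW : ∀ i, IsOrthonormalPolarFactor (W i) (H i)) (hP : ∀ i, P i ∈ stiefel n k)
    (hgain : Summable fun i => linearGain (H i) (P i) (W i)) :
    Summable fun i => sigmaMin (H i) * sinThetaNorm (colSpace (W i)) (colSpace (P i)) ^ 2 :=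
  summable_sigmaMin_mul_of_le_frobNorm_sub_sq hW hP hgain (fun _ => sq_nonneg _)
    fun i => sinThetaNorm_colSpace_sq_le (W i) (hP i)

lemma summable_sigmaMin_mul_frobNorm_residual_div
    (hW : ∀ i, IsOrthonormalPolarFactor (W i) (H i)) (hP : ∀ i, P i ∈ stiefel n k)
    (hgain : Summable fun i => linearGain (H i) (P i) (W i)) :
    Summable fun i => sigmaMin (H i) *
      (frobNorm (H i - P i * ((P i)ᴴ * H i)) ^ 2 / frobNorm (H i) ^ 2) :=
  summable_sigmaMin_mul_of_le_frobNorm_sub_sq hW hP hgain (fun _ => by positivity)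
    fun i => frobNorm_residual_div_le (hW i) (hP i)

end PolarSequences

section Objective

variable {n₁ n₂ k N : ℕ} {τ : Composition k} {B : Fin N → Matrix (Fin n₁) (Fin n₂) ℂ}

lemma gradV_eq_gradU_conjTranspose (U : Matrix (Fin n₁) (Fin k) ℂ)
    (V : Matrix (Fin n₂) (Fin k) ℂ) : gradV τ B U V = gradU τ (fun l => (B l)ᴴ) V U := by
  simp [gradU, gradV]

lemma objective_nonneg (U : Matrix (Fin n₁) (Fin k) ℂ) (V : Matrix (Fin n₂) (Fin k) ℂ) :
    0 ≤ objective τ B U V :=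
  Finset.sum_nonneg fun _ _ => sq_nonneg _

lemma objective_le (U : Matrix (Fin n₁) (Fin k) ℂ) (V : Matrix (Fin n₂) (Fin k) ℂ) :
    objective τ B U V ≤ frobNorm U ^ 2 * (∑ l, frobNorm (B l) ^ 2) * frobNorm V ^ 2 := by
  rw [objective, Finset.mul_sum, Finset.sum_mul]
  refine Finset.sum_le_sum fun l _ => ?_
  calc frobNorm (blockDiagPart τ (Uᴴ * B l * V)) ^ 2
      ≤ frobNorm (Uᴴ * B l * V) ^ 2 := frobNorm_blockDiagPart_sq_le τ _
    _ ≤ frobNorm (Uᴴ * B l) ^ 2 * frobNorm V ^ 2 := frobNorm_mul_sq_le _ _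
    _ ≤ frobNorm U ^ 2 * frobNorm (B l) ^ 2 * frobNorm V ^ 2 := by
        gcongr
        rw [← frobNorm_conjTranspose U]
        exact frobNorm_mul_sq_le _ _

lemma objective_add_linearGain_gradU_le (U W : Matrix (Fin n₁) (Fin k) ℂ)
    (V : Matrix (Fin n₂) (Fin k) ℂ) :
    objective τ B U V + linearGain (gradU τ B U V) U W ≤ objective τ B W V := by
  have hexpand := objective_add_left τ B U (W - U) V
  rw [add_sub_cancel] at hexpand
  rw [hexpand, linearGain]
  exact le_add_of_nonneg_right (objective_nonneg (W - U) V)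

lemma objective_add_linearGain_gradV_le (U : Matrix (Fin n₁) (Fin k) ℂ)
    (V W : Matrix (Fin n₂) (Fin k) ℂ) :
    objective τ B U V + linearGain (gradV τ B U V) V W ≤ objective τ B U W := by
  rw [objective_swap τ B U V, objective_swap τ B U W, gradV_eq_gradU_conjTranspose]
  exact objective_add_linearGain_gradU_le V W U

lemma continuous_blockDiagPart : Continuous (blockDiagPart τ) := by
  refine continuous_matrix fun i j => ?_
  by_cases h : τ.index i = τ.index j
  · simpa [blockDiagPart, h] using continuous_id.matrix_elem i j
  · simpa [blockDiagPart, h] using continuous_const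

lemma continuous_gradU :
    Continuous fun p : Matrix (Fin n₁) (Fin k) ℂ × Matrix (Fin n₂) (Fin k) ℂ =>
      gradU τ B p.1 p.2 := by
  have hblock := continuous_blockDiagPart (τ := τ)
  unfold gradU
  fun_prop

variable {ι : Type*} {F : Filter ι} {u : ι → Matrix (Fin n₁) (Fin k) ℂ}
  {v : ι → Matrix (Fin n₂) (Fin k) ℂ} {Us : Matrix (Fin n₁) (Fin k) ℂ}
  {Vs : Matrix (Fin n₂) (Fin k) ℂ}

lemma tendsto_gradU (hu : Tendsto u F (𝓝 Us)) (hv : Tendsto v F (𝓝 Vs)) :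
    Tendsto (fun i => gradU τ B (u i) (v i)) F (𝓝 (gradU τ B Us Vs)) := by
  have hcont := (continuous_gradU (τ := τ) (B := B)).tendsto (Us, Vs)
  simpa only [Function.comp_def] using hcont.comp (hu.prodMk_nhds hv)

lemma tendsto_gradV (hu : Tendsto u F (𝓝 Us)) (hv : Tendsto v F (𝓝 Vs)) :
    Tendsto (fun i => gradV τ B (u i) (v i)) F (𝓝 (gradV τ B Us Vs)) := by
  simp only [gradV_eq_gradU_conjTranspose]
  exact tendsto_gradU hv hu

end Objective

namespace IsGaussSeidelASCF

variable {n₁ n₂ k N : ℕ} {τ : Composition k} {B : Fin N → Matrix (Fin n₁) (Fin n₂) ℂ}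
  {U : ℕ → Matrix (Fin n₁) (Fin k) ℂ} {V : ℕ → Matrix (Fin n₂) (Fin k) ℂ}

lemma U_mem (h : IsGaussSeidelASCF τ B U V) : ∀ j, U j ∈ stiefel n₁ k
  | 0 => h.init_U
  | j + 1 => (h.step_U j).1

lemma V_mem (h : IsGaussSeidelASCF τ B U V) : ∀ j, V j ∈ stiefel n₂ k
  | 0 => h.init_V
  | j + 1 => (h.step_V j).1

lemma linearGain_U_nonneg (h : IsGaussSeidelASCF τ B U V) (j : ℕ) :
    0 ≤ linearGain (gradU τ B (U j) (V j)) (U j) (U (j + 1)) :=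
  linearGain_nonneg (h.step_U j) (h.U_mem j)

lemma linearGain_V_nonneg (h : IsGaussSeidelASCF τ B U V) (j : ℕ) :
    0 ≤ linearGain (gradV τ B (U (j + 1)) (V j)) (V j) (V (j + 1)) :=
  linearGain_nonneg (h.step_V j) (h.V_mem j)

lemma linearGain_U_le_objective_sub (h : IsGaussSeidelASCF τ B U V) (j : ℕ) :
    linearGain (gradU τ B (U j) (V j)) (U j) (U (j + 1)) ≤
      objective τ B (U (j + 1)) (V (j + 1)) - objective τ B (U j) (V j) := by
  linarith [objective_add_linearGain_gradU_le (τ := τ) (B := B) (U j) (U (j + 1)) (V j),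
    objective_add_linearGain_gradV_le (τ := τ) (B := B) (U (j + 1)) (V j) (V (j + 1)),
    h.linearGain_V_nonneg j]

lemma linearGain_V_le_objective_sub (h : IsGaussSeidelASCF τ B U V) (j : ℕ) :
    linearGain (gradV τ B (U (j + 1)) (V j)) (V j) (V (j + 1)) ≤
      objective τ B (U (j + 1)) (V (j + 1)) - objective τ B (U j) (V j) := by
  linarith [objective_add_linearGain_gradU_le (τ := τ) (B := B) (U j) (U (j + 1)) (V j),
    objective_add_linearGain_gradV_le (τ := τ) (B := B) (U (j + 1)) (V j) (V (j + 1)),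
    h.linearGain_U_nonneg j]

lemma monotone_objective (h : IsGaussSeidelASCF τ B U V) :
    Monotone fun j => objective τ B (U j) (V j) :=
  monotone_nat_of_le_succ fun j =>
    sub_nonneg.mp ((h.linearGain_U_nonneg j).trans (h.linearGain_U_le_objective_sub j))

lemma bddAbove_objective (h : IsGaussSeidelASCF τ B U V) :
    BddAbove (Set.range fun j => objective τ B (U j) (V j)) := by
  refine ⟨k * (∑ l, frobNorm (B l) ^ 2) * k, Set.forall_mem_range.mpr fun j => ?_⟩
  simpa only [frobNorm_sq_of_mem_stiefel (h.U_mem j), frobNorm_sq_of_mem_stiefel (h.V_mem j)]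
    using objective_le (τ := τ) (B := B) (U j) (V j)

lemma summable_linearGain_U (h : IsGaussSeidelASCF τ B U V) :
    Summable fun j => linearGain (gradU τ B (U j) (V j)) (U j) (U (j + 1)) :=
  summable_of_le_sub_of_bddAbove h.bddAbove_objective h.linearGain_U_nonneg
    h.linearGain_U_le_objective_sub

lemma summable_linearGain_V (h : IsGaussSeidelASCF τ B U V) :
    Summable fun j => linearGain (gradV τ B (U (j + 1)) (V j)) (V j) (V (j + 1)) :=
  summable_of_le_sub_of_bddAbove h.bddAbove_objective h.linearGain_V_nonneg
    h.linearGain_V_le_objective_sub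

variable {ι : Type*} {F : Filter ι} {φ : ι → ℕ} {Us Uh : Matrix (Fin n₁) (Fin k) ℂ}
  {Vs : Matrix (Fin n₂) (Fin k) ℂ}

lemma polarKKT_gradU [F.NeBot] (h : IsGaussSeidelASCF τ B U V) (hφ : Tendsto φ F atTop)
    (hUs : Tendsto (fun i => U (φ i)) F (𝓝 Us)) (hVs : Tendsto (fun i => V (φ i)) F (𝓝 Vs)) :
    PolarKKT Us (gradU τ B Us Vs) :=
  polarKKT_of_tendsto_linearGain (fun i => h.step_U (φ i)) (fun i => h.U_mem (φ i)) hUs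
    (tendsto_gradU hUs hVs)
    (h.summable_linearGain_U.tendsto_atTop_zero.comp hφ)

lemma tendsto_U_succ (h : IsGaussSeidelASCF τ B U V) (hφ : Tendsto φ F atTop)
    (hUs : Tendsto (fun i => U (φ i)) F (𝓝 Us)) (hVs : Tendsto (fun i => V (φ i)) F (𝓝 Vs))
    (hrank : (gradU τ B Us Vs).rank = k) : Tendsto (fun i => U (φ i + 1)) F (𝓝 Us) :=
  tendsto_of_tendsto_linearGain (fun i => h.step_U (φ i)) (fun i => h.U_mem (φ i)) hUs
    (tendsto_gradU hUs hVs)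
    (h.summable_linearGain_U.tendsto_atTop_zero.comp hφ) hrank

lemma tendsto_V_succ (h : IsGaussSeidelASCF τ B U V) (hφ : Tendsto φ F atTop)
    (hUh : Tendsto (fun i => U (φ i + 1)) F (𝓝 Uh)) (hVs : Tendsto (fun i => V (φ i)) F (𝓝 Vs))
    (hrank : (gradV τ B Uh Vs).rank = k) : Tendsto (fun i => V (φ i + 1)) F (𝓝 Vs) :=
  tendsto_of_tendsto_linearGain (fun i => h.step_V (φ i)) (fun i => h.V_mem (φ i)) hVs
    (tendsto_gradV hUh hVs)
    (h.summable_linearGain_V.tendsto_atTop_zero.comp hφ) hrank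

lemma polarKKT_gradV_of_mapClusterPt (h : IsGaussSeidelASCF τ B U V) (hφ : Tendsto φ F atTop)
    (hVs : Tendsto (fun i => V (φ i)) F (𝓝 Vs)) (hUh : MapClusterPt Uh F fun i => U (φ i + 1)) :
    PolarKKT Vs (gradV τ B Uh Vs) := by
  obtain ⟨G, hGF, hG⟩ := mapClusterPt_iff_ultrafilter.mp hUh
  have hVs_G := hVs.mono_left hGF
  exact polarKKT_of_tendsto_linearGain (fun i => h.step_V (φ i)) (fun i => h.V_mem (φ i)) hVs_G
    (tendsto_gradV hG hVs_G)
    (h.summable_linearGain_V.tendsto_atTop_zero.comp (hφ.mono_left hGF))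

lemma exists_mapClusterPt_U_succ (h : IsGaussSeidelASCF τ B U V) (F : Filter ι) [F.NeBot]
    (φ : ι → ℕ) : ∃ Uh, MapClusterPt Uh F fun i => U (φ i + 1) := by
  obtain ⟨Uh, -, hUh⟩ := isCompact_stiefel.exists_mapClusterPt (f := F) <| tendsto_principal.mpr <|
    Eventually.of_forall fun i => h.U_mem (φ i + 1)
  exact ⟨Uh, hUh⟩

lemma eq_of_mapClusterPt_U_succ (h : IsGaussSeidelASCF τ B U V) (hφ : Tendsto φ F atTop)
    (hUs : Tendsto (fun i => U (φ i)) F (𝓝 Us)) (hVs : Tendsto (fun i => V (φ i)) F (𝓝 Vs))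
    (hrank : (gradU τ B Us Vs).rank = k) (hUh : MapClusterPt Uh F fun i => U (φ i + 1)) :
    Uh = Us :=
  eq_of_nhds_neBot (hUh.clusterPt.mono (h.tendsto_U_succ hφ hUs hVs hrank))

lemma tendsto_of_isIsolatedAccPt (h : IsGaussSeidelASCF τ B U V)
    (hiso : IsIsolatedAccPt (fun j => (U j, V j)) (Us, Vs))
    (hrankU : (gradU τ B Us Vs).rank = k) (hrankV : (gradV τ B Us Vs).rank = k) :
    Tendsto (fun j => (U j, V j)) atTop (𝓝 (Us, Vs)) := by
  refine hiso.tendsto_of_tendsto_succ (isCompact_stiefel.prod isCompact_stiefel)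
    (fun j => ⟨h.U_mem j, h.V_mem j⟩) fun F hF hlim => ?_
  have hUs := h.tendsto_U_succ (φ := id) hF hlim.fst_nhds hlim.snd_nhds hrankU
  exact hUs.prodMk_nhds (h.tendsto_V_succ (φ := id) hF hUs hlim.snd_nhds hrankV)

end IsGaussSeidelASCF

end JointSVD

open JointSVD in
theorem mainTheorem1 {n₁ n₂ k N : ℕ} (hk : 1 ≤ k) (hkn : k ≤ min n₁ n₂)
    (τ : Composition k) (B : Fin N → Matrix (Fin n₁) (Fin n₂) ℂ)
    (U : ℕ → Matrix (Fin n₁) (Fin k) ℂ) (V : ℕ → Matrix (Fin n₂) (Fin k) ℂ)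
    (hUV : IsGaussSeidelASCF τ B U V) :
    -- (a)
    (Monotone (fun j => objective τ B (U j) (V j)) ∧
      ∃ L : ℝ, Tendsto (fun j => objective τ B (U j) (V j)) atTop (𝓝 L)) ∧
    -- (b)
    (∀ (Us : Matrix (Fin n₁) (Fin k) ℂ) (Vs : Matrix (Fin n₂) (Fin k) ℂ) (φ : ℕ → ℕ),
      StrictMono φ → Tendsto (fun i => (U (φ i), V (φ i))) atTop (𝓝 (Us, Vs)) →
      PolarKKT Us (gradU τ B Us Vs) ∧
      (∃ Uh, MapClusterPt Uh atTop (fun i => U (φ i + 1))) ∧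
      ∀ Uh, MapClusterPt Uh atTop (fun i => U (φ i + 1)) →
        PolarKKT Vs (gradV τ B Uh Vs) ∧
        (Uh = Us → PolarKKT Us (gradU τ B Us Vs) ∧ PolarKKT Vs (gradV τ B Us Vs))) ∧
    -- (c)
    (∀ (Us : Matrix (Fin n₁) (Fin k) ℂ) (Vs : Matrix (Fin n₂) (Fin k) ℂ) (φ : ℕ → ℕ),
      StrictMono φ → Tendsto (fun i => (U (φ i), V (φ i))) atTop (𝓝 (Us, Vs)) →
      (gradU τ B Us Vs).rank = k →
      (∀ Uh, MapClusterPt Uh atTop (fun i => U (φ i + 1)) → Uh = Us) ∧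
      PolarKKT Us (gradU τ B Us Vs) ∧ PolarKKT Vs (gradV τ B Us Vs)) ∧
    -- (d)
    (∀ (Us : Matrix (Fin n₁) (Fin k) ℂ) (Vs : Matrix (Fin n₂) (Fin k) ℂ),
      IsIsolatedAccPt (fun j => (U j, V j)) (Us, Vs) →
      (gradU τ B Us Vs).rank = k → (gradV τ B Us Vs).rank = k →
      Tendsto (fun j => (U j, V j)) atTop (𝓝 (Us, Vs))) ∧
    -- (e)
    (Summable (fun j => sigmaMin (gradU τ B (U j) (V j)) *
        sinThetaNorm (colSpace (U (j + 1))) (colSpace (U j)) ^ 2) ∧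
      Summable (fun j => sigmaMin (gradV τ B (U (j + 1)) (V j)) *
        sinThetaNorm (colSpace (V (j + 1))) (colSpace (V j)) ^ 2) ∧
      Summable (fun j => sigmaMin (gradU τ B (U j) (V j)) *
        (frobNorm (gradU τ B (U j) (V j) - U j * ((U j)ᴴ * gradU τ B (U j) (V j))) ^ 2 /
          frobNorm (gradU τ B (U j) (V j)) ^ 2)) ∧
      Summable (fun j => sigmaMin (gradV τ B (U (j + 1)) (V j)) *
        (frobNorm (gradV τ B (U (j + 1)) (V j) -
            V j * ((V j)ᴴ * gradV τ B (U (j + 1)) (V j))) ^ 2 /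
          frobNorm (gradV τ B (U (j + 1)) (V j)) ^ 2))) := by
  refine ⟨⟨hUV.monotone_objective,
    _, tendsto_atTop_ciSup hUV.monotone_objective hUV.bddAbove_objective⟩, ?_, ?_,
    fun _ _ hiso hrankU hrankV => hUV.tendsto_of_isIsolatedAccPt hiso hrankU hrankV,
    summable_sigmaMin_mul_sinThetaNorm_sq hUV.step_U hUV.U_mem hUV.summable_linearGain_U,
    summable_sigmaMin_mul_sinThetaNorm_sq hUV.step_V hUV.V_mem hUV.summable_linearGain_V,
    summable_sigmaMin_mul_frobNorm_residual_div hUV.step_U hUV.U_mem hUV.summable_linearGain_U,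
    summable_sigmaMin_mul_frobNorm_residual_div hUV.step_V hUV.V_mem hUV.summable_linearGain_V⟩
  · intro Us Vs φ hφ hlim
    have hKKT_U : PolarKKT Us (gradU τ B Us Vs) :=
      hUV.polarKKT_gradU hφ.tendsto_atTop hlim.fst_nhds hlim.snd_nhds
    refine ⟨hKKT_U, hUV.exists_mapClusterPt_U_succ atTop φ, fun Uh hUh => ?_⟩
    have hKKT_V : PolarKKT Vs (gradV τ B Uh Vs) :=
      hUV.polarKKT_gradV_of_mapClusterPt hφ.tendsto_atTop hlim.snd_nhds hUh
    exact ⟨hKKT_V, fun hUh_eq => ⟨hKKT_U, hUh_eq ▸ hKKT_V⟩⟩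
  · intro Us Vs φ hφ hlim hrank
    have huniq (Uh) (hUh : MapClusterPt Uh atTop fun i => U (φ i + 1)) : Uh = Us :=
      hUV.eq_of_mapClusterPt_U_succ hφ.tendsto_atTop hlim.fst_nhds hlim.snd_nhds hrank hUh
    obtain ⟨Uh, hUh⟩ := hUV.exists_mapClusterPt_U_succ atTop φ
    obtain rfl := huniq Uh hUh
    exact ⟨huniq, hUV.polarKKT_gradU hφ.tendsto_atTop hlim.fst_nhds hlim.snd_nhds,
      hUV.polarKKT_gradV_of_mapClusterPt hφ.tendsto_atTop hlim.snd_nhds hUh⟩
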